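/- Consider, for a parameter $\beta\in\mathbb{C}$, the equation $$w''''+5w'w''-5w^2w''-5w(w')^2+w^5-zw-\beta=0,\qquad{}'=\frac{d}{dz},\tag{$*$}$$ and its rational solutions $w\in\mathbb{C}(z)$. (i) Equation $(*)$ has a rational solution if and only if $\beta\in\mathbb{Z}\setminus\{1\pm3k : k\in\mathbb{Z},\ k\ge 0\}$. (ii) For each $\beta$ there is at most one rational solution. (iii) For $n\ge 1$ put $$\beta_n^{(1)}=(-1)^n\left(3\left[\tfrac{n+1}{2}\right]-1+(-1)^n\right),\qquad \beta_n^{(2)}=(-1)^{n+1}\left(3\left[\tfrac{n}{2}\right]+1+(-1)^{n+1}\right),$$ where $[x]$ is the integer part of $x$. There exist sequences $(Q_n)_{n\ge0}$ and $(R_n)_{n\ge0}$ of monic polynomials in $\mathbb{C}[z]$ with $Q_0=R_0=1$ such that, for every $n\ge1$, $$w(z;\beta_n^{(1)})=(-1)^n\frac{d}{dz}\ln\frac{Q_{n-1}}{Q_n},\qquad w(z;\beta_n^{(2)})=(-1)^{n-1}\frac{d}{dz}\ln\frac{R_{n-1}}{R_n}$$ are rational solutions of $(*)$ at $\beta=\beta_n^{(1)}$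 and $\beta=\beta_n^{(2)}$ respectively. Besides these, $w=0$ is a solution at $\beta=0$, and every rational solution of $(*)$, at any $\beta\in\mathbb{C}$, is one of those listed. Here $\frac{d}{dz}\ln f$ means $f'/f$. -/

import Mathlib

open Polynomial

noncomputable section

namespace FourthPainleve

/-- The derivative `d/dz` of a rational function in one variable `z` over `ℂ`,
by the quotient rule applied to its reduced fraction. -/
def ratDeriv (w : RatFunc ℂ) : RatFunc ℂ :=
  algebraMap ℂ[X] (RatFunc ℂ)
      (derivative w.num * w.denom - w.num * derivative w.denom) /
    algebraMap ℂ[X] (RatFunc ℂ) w.denom ^ 2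

/-- The quotient rule holds for every representation as a fraction of polynomials. -/
theorem ratDeriv_div (p q : ℂ[X]) (hq : q ≠ 0) :
    ratDeriv (algebraMap ℂ[X] (RatFunc ℂ) p / algebraMap ℂ[X] (RatFunc ℂ) q) =
      algebraMap ℂ[X] (RatFunc ℂ) (derivative p * q - p * derivative q) /
        algebraMap ℂ[X] (RatFunc ℂ) q ^ 2 := by
  set w : RatFunc ℂ := algebraMap ℂ[X] (RatFunc ℂ) p / algebraMap ℂ[X] (RatFunc ℂ) q with hw
  have hd : w.denom ≠ 0 := RatFunc.denom_ne_zero w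
  have inj := RatFunc.algebraMap_injective ℂ
  have hq' : algebraMap ℂ[X] (RatFunc ℂ) q ≠ 0 := RatFunc.algebraMap_ne_zero hq
  have hd' : algebraMap ℂ[X] (RatFunc ℂ) w.denom ≠ 0 := RatFunc.algebraMap_ne_zero hd
  have hcross : w.num * q = p * w.denom := by
    apply inj
    rw [map_mul, map_mul]
    have h := RatFunc.num_div_denom w
    rw [hw, div_eq_div_iff (hw ▸ hd') hq'] at h
    exact h
  have hder : derivative w.num * q + w.num * derivative q =
      derivative p * w.denom + p * derivative w.denom := by
    simpa only [derivative_mul] using congrArg derivative hcross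
  have key : (derivative w.num * w.denom - w.num * derivative w.denom) * q ^ 2 =
      (derivative p * q - p * derivative q) * w.denom ^ 2 := by
    linear_combination (q * w.denom) * hder -
      (q * derivative w.denom + w.denom * derivative q) * hcross
  unfold ratDeriv
  rw [div_eq_div_iff (pow_ne_zero 2 hd') (pow_ne_zero 2 hq'), ← map_pow, ← map_pow,
    ← map_mul, ← map_mul, key]

/-- The logarithmic derivative `d/dz ln f = f' / f` of a rational function. -/
def ratLogDeriv (f : RatFunc ℂ) : RatFunc ℂ := ratDeriv f / f

/-- `w` is a rational solution, at the parameter `β`, of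
`w'''' + 5 w' w'' - 5 w² w'' - 5 w (w')² + w⁵ - z w - β = 0`. -/
def IsRationalSolution (β : ℂ) (w : RatFunc ℂ) : Prop :=
  ratDeriv^[4] w + 5 * ratDeriv w * ratDeriv^[2] w - 5 * w ^ 2 * ratDeriv^[2] w
    - 5 * w * ratDeriv w ^ 2 + w ^ 5 - RatFunc.X * w - RatFunc.C β = 0

/-- `β_n^{(1)} = (-1)^n (3 [(n+1)/2] - 1 + (-1)^n)`. -/
def betaOne (n : ℕ) : ℤ := (-1) ^ n * (3 * (((n + 1) / 2 : ℕ) : ℤ) - 1 + (-1) ^ n)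

/-- `β_n^{(2)} = (-1)^{n+1} (3 [n/2] + 1 + (-1)^{n+1})`. -/
def betaTwo (n : ℕ) : ℤ := (-1) ^ (n + 1) * (3 * ((n / 2 : ℕ) : ℤ) + 1 + (-1) ^ (n + 1))

/-- `(-1)^n d/dz ln (Q_{n-1} / Q_n)`, used for `n ≥ 1`. -/
def solOne (Q : ℕ → ℂ[X]) (n : ℕ) : RatFunc ℂ :=
  (-1) ^ n * ratLogDeriv
    (algebraMap ℂ[X] (RatFunc ℂ) (Q (n - 1)) / algebraMap ℂ[X] (RatFunc ℂ) (Q n))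

/-- `(-1)^{n-1} d/dz ln (R_{n-1} / R_n)`, used for `n ≥ 1`. -/
def solTwo (R : ℕ → ℂ[X]) (n : ℕ) : RatFunc ℂ :=
  (-1) ^ (n - 1) * ratLogDeriv
    (algebraMap ℂ[X] (RatFunc ℂ) (R (n - 1)) / algebraMap ℂ[X] (RatFunc ℂ) (R n))

end FourthPainleve

end

noncomputable section

namespace FourthPainleve

/-! Put u = w² - 2w' and v = w² + w'. With D = 2z + u'' - 2u² the equation reads D' + wD = 2 - 2β;
with E = z + 2v'' - v² it reads E' - 2wE = 1 + 2β. Adding a suitable constant multiple of 1/D (or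
1/E) to w therefore keeps u (or v) and sends β to 2 - β (or -1 - β). Alternating the two moves from
w = 0, with either one first, reaches every integer not congruent to 1 mod 3: this is existence.

Uniqueness is forced at infinity (`solution_unique`): solutions decay, so in the difference of two
equations the term z(v - w) has no competitor.

For necessity, `exists_residue` shows that every pole is simple with residue 1, -2, -3 or 4 and that
the constant term there vanishes. So u and v have pure double poles, with coefficients 3n and 3m
where n - m is the residue. A rational function without poles that vanishes at infinity is zero,
which yields `exists_tau`: w = (ln N/T)', 3(ln N)'' = -u, 3(ln T)'' = -v. Comparing leading terms at
infinity, β = deg T - deg N and 3 deg N = β² - 2β, hence β is an integer not congruent to 1 mod 3.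

Finally, a move that keeps u keeps N'/N, and one that keeps v keeps T'/T. Along each chain the
polynomials N and T thus interlace into one sequence, Q or R. -/

/-! ### Differentiation rules for rational functions. -/

theorem exists_eq_div (f : RatFunc ℂ) : ∃ p q : ℂ[X], q ≠ 0 ∧
    f = algebraMap ℂ[X] (RatFunc ℂ) p / algebraMap ℂ[X] (RatFunc ℂ) q :=
  ⟨f.num, f.denom, f.denom_ne_zero, f.num_div_denom.symm⟩

theorem ratDeriv_algebraMap (p : ℂ[X]) :
    ratDeriv (algebraMap ℂ[X] (RatFunc ℂ) p) = algebraMap ℂ[X] (RatFunc ℂ) (derivative p) := by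
  simpa using ratDeriv_div p 1 one_ne_zero

theorem ratDeriv_add (f g : RatFunc ℂ) : ratDeriv (f + g) = ratDeriv f + ratDeriv g := by
  obtain ⟨p, q, hq, rfl⟩ := exists_eq_div f
  obtain ⟨r, s, hs, rfl⟩ := exists_eq_div g
  have hq' := RatFunc.algebraMap_ne_zero (K := ℂ) hq
  have hs' := RatFunc.algebraMap_ne_zero (K := ℂ) hs
  rw [div_add_div _ _ hq' hs', ← map_mul, ← map_mul, ← map_mul, ← map_add,
    ratDeriv_div _ _ (mul_ne_zero hq hs), ratDeriv_div _ _ hq, ratDeriv_div _ _ hs]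
  simp only [derivative_mul, map_sub, map_add, map_mul]
  field_simp
  ring

theorem ratDeriv_mul (f g : RatFunc ℂ) :
    ratDeriv (f * g) = ratDeriv f * g + f * ratDeriv g := by
  obtain ⟨p, q, hq, rfl⟩ := exists_eq_div f
  obtain ⟨r, s, hs, rfl⟩ := exists_eq_div g
  have hq' := RatFunc.algebraMap_ne_zero (K := ℂ) hq
  have hs' := RatFunc.algebraMap_ne_zero (K := ℂ) hs
  rw [div_mul_div_comm, ← map_mul, ← map_mul,
    ratDeriv_div _ _ (mul_ne_zero hq hs), ratDeriv_div _ _ hq, ratDeriv_div _ _ hs]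
  simp only [derivative_mul, map_sub, map_add, map_mul]
  field_simp
  ring

theorem ratDeriv_C (a : ℂ) : ratDeriv (RatFunc.C a) = 0 := by
  rw [← RatFunc.algebraMap_C, ratDeriv_algebraMap, derivative_C, map_zero]

theorem ratDeriv_X : ratDeriv RatFunc.X = 1 := by
  rw [← RatFunc.algebraMap_X, ratDeriv_algebraMap, derivative_X, map_one]

theorem ratDeriv_zero : ratDeriv 0 = 0 := by
  simpa using ratDeriv_C 0

theorem ratDeriv_one : ratDeriv 1 = 0 := by
  simpa using ratDeriv_C 1

theorem ratDeriv_C_mul (a : ℂ) (f : RatFunc ℂ) :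
    ratDeriv (RatFunc.C a * f) = RatFunc.C a * ratDeriv f := by
  rw [ratDeriv_mul, ratDeriv_C, zero_mul, zero_add]

theorem ratDeriv_neg (f : RatFunc ℂ) : ratDeriv (-f) = -ratDeriv f := by
  have := ratDeriv_C_mul (-1) f
  simpa using this

theorem ratDeriv_sub (f g : RatFunc ℂ) : ratDeriv (f - g) = ratDeriv f - ratDeriv g := by
  rw [sub_eq_add_neg, ratDeriv_add, ratDeriv_neg, sub_eq_add_neg]

theorem ratDeriv_ofNat (n : ℕ) [n.AtLeastTwo] :
    ratDeriv (no_index (OfNat.ofNat n : RatFunc ℂ)) = 0 := by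
  rw [← map_ofNat (RatFunc.C (K := ℂ)) n, ratDeriv_C]

theorem ratDeriv_natCast_mul (n : ℕ) (f : RatFunc ℂ) :
    ratDeriv (n * f) = n * ratDeriv f := by
  have := ratDeriv_C_mul n f
  simpa using this

theorem ratDeriv_sq (f : RatFunc ℂ) : ratDeriv (f ^ 2) = 2 * f * ratDeriv f := by
  rw [sq, ratDeriv_mul]; ring

theorem ratDeriv_sum {ι : Type*} (s : Finset ι) (f : ι → RatFunc ℂ) :
    ratDeriv (∑ i ∈ s, f i) = ∑ i ∈ s, ratDeriv (f i) :=
  map_sum (⟨⟨ratDeriv, ratDeriv_zero⟩, ratDeriv_add⟩ : RatFunc ℂ →+ RatFunc ℂ) f s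

theorem ratDeriv_inv {f : RatFunc ℂ} (hf : f ≠ 0) :
    ratDeriv f⁻¹ = -ratDeriv f / f ^ 2 := by
  have h : ratDeriv (f * f⁻¹) = 0 := by rw [mul_inv_cancel₀ hf, ratDeriv_one]
  rw [ratDeriv_mul] at h
  field_simp at h ⊢
  linear_combination h

theorem ratLogDeriv_mul {f g : RatFunc ℂ} (hf : f ≠ 0) (hg : g ≠ 0) :
    ratLogDeriv (f * g) = ratLogDeriv f + ratLogDeriv g := by
  unfold ratLogDeriv
  rw [ratDeriv_mul]
  field_simp

theorem ratLogDeriv_one : ratLogDeriv 1 = 0 := by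
  rw [ratLogDeriv, ratDeriv_one, zero_div]

theorem ratLogDeriv_div {f g : RatFunc ℂ} (hf : f ≠ 0) (hg : g ≠ 0) :
    ratLogDeriv (f / g) = ratLogDeriv f - ratLogDeriv g := by
  have h := ratLogDeriv_mul (div_ne_zero hf hg) hg
  rw [div_mul_cancel₀ _ hg] at h
  rw [h, add_sub_cancel_right]

theorem ratLogDeriv_pow {f : RatFunc ℂ} (hf : f ≠ 0) (n : ℕ) :
    ratLogDeriv (f ^ n) = n * ratLogDeriv f := by
  induction n with
  | zero => simp [ratLogDeriv_one]
  | succ n ih =>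
    rw [pow_succ, ratLogDeriv_mul (pow_ne_zero n hf) hf, ih]
    push_cast
    ring

theorem ratLogDeriv_prod {ι : Type*} (s : Finset ι) (f : ι → RatFunc ℂ)
    (hf : ∀ i ∈ s, f i ≠ 0) :
    ratLogDeriv (∏ i ∈ s, f i) = ∑ i ∈ s, ratLogDeriv (f i) := by
  classical
  induction s using Finset.induction_on with
  | empty => simp [ratLogDeriv_one]
  | insert a s ha ih =>
    rw [Finset.prod_insert ha, Finset.sum_insert ha,
      ratLogDeriv_mul (hf a (Finset.mem_insert_self a s))
        (Finset.prod_ne_zero_iff.2 fun i hi => hf i (Finset.mem_insert_of_mem hi)),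
      ih fun i hi => hf i (Finset.mem_insert_of_mem hi)]

/-! ### The two Miura maps and the Bäcklund transformations -/

/-- The Miura transform `w² - 2w'`. -/
def miuraOne (w : RatFunc ℂ) : RatFunc ℂ := w ^ 2 - 2 * ratDeriv w

/-- The Miura transform `w² + w'`. -/
def miuraTwo (w : RatFunc ℂ) : RatFunc ℂ := w ^ 2 + ratDeriv w

/-- The denominator `2z + u'' - 2u²` of the first Bäcklund transformation. -/
def auxOne (u : RatFunc ℂ) : RatFunc ℂ :=
  2 * RatFunc.X + ratDeriv (ratDeriv u) - 2 * u ^ 2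

/-- The denominator `z + 2v'' - v²` of the second Bäcklund transformation. -/
def auxTwo (v : RatFunc ℂ) : RatFunc ℂ :=
  RatFunc.X + 2 * ratDeriv (ratDeriv v) - v ^ 2

theorem isRationalSolution_iff_auxOne (β : ℂ) (w : RatFunc ℂ) :
    IsRationalSolution β w ↔
      ratDeriv (auxOne (miuraOne w)) + w * auxOne (miuraOne w) = RatFunc.C (2 - 2 * β) := by
  unfold IsRationalSolution auxOne miuraOne
  simp only [Function.iterate_succ, Function.iterate_zero, Function.comp_apply, id_eq,
    ratDeriv_sub, ratDeriv_add, ratDeriv_sq, ratDeriv_mul, ratDeriv_ofNat, ratDeriv_zero, ratDeriv_X,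
    map_sub, map_mul, map_ofNat]
  generalize ratDeriv (ratDeriv (ratDeriv (ratDeriv w))) = w4
  generalize ratDeriv (ratDeriv (ratDeriv w)) = w3
  generalize ratDeriv (ratDeriv w) = w2
  generalize ratDeriv w = w1
  constructor
  · intro h
    linear_combination -2 * h
  · intro h
    linear_combination -h / 2

theorem isRationalSolution_iff_auxTwo (β : ℂ) (w : RatFunc ℂ) :
    IsRationalSolution β w ↔
      ratDeriv (auxTwo (miuraTwo w)) - 2 * w * auxTwo (miuraTwo w) = RatFunc.C (1 + 2 * β) := by
  unfold IsRationalSolution auxTwo miuraTwo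
  simp only [Function.iterate_succ, Function.iterate_zero, Function.comp_apply, id_eq,
    ratDeriv_sub, ratDeriv_add, ratDeriv_sq, ratDeriv_mul, ratDeriv_ofNat, ratDeriv_zero, ratDeriv_X,
    map_add, map_mul, map_one, map_ofNat]
  generalize ratDeriv (ratDeriv (ratDeriv (ratDeriv w))) = w4
  generalize ratDeriv (ratDeriv (ratDeriv w)) = w3
  generalize ratDeriv (ratDeriv w) = w2
  generalize ratDeriv w = w1
  constructor
  · intro h
    linear_combination 2 * h
  · intro h
    linear_combination h / 2

/-- Keeping w² - 2w' under w ↦ w + f is the Bernoulli equation 2wf + f² = 2f'. For f = c/D it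
becomes c = -2(D' + wD), which is the constant 4β - 4. -/
theorem exists_solution_two_sub {β : ℂ} {w : RatFunc ℂ} (hw : IsRationalSolution β w)
    (hβ : β ≠ 1) :
    ∃ w', IsRationalSolution (2 - β) w' ∧ miuraOne w' = miuraOne w := by
  have h := (isRationalSolution_iff_auxOne β w).1 hw
  set D := auxOne (miuraOne w) with hD
  -- A vanishing D would turn the first-order equation into 2 - 2β = 0.
  have hD0 : D ≠ 0 := by
    intro h0
    rw [h0, ratDeriv_zero, mul_zero, add_zero, eq_comm, map_eq_zero] at h
    exact hβ (by linear_combination -h / 2)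
  have hm : miuraOne (w + RatFunc.C (4 * β - 4) * D⁻¹) = miuraOne w := by
    unfold miuraOne
    rw [ratDeriv_add, ratDeriv_C_mul, ratDeriv_inv hD0, eq_sub_of_add_eq h]
    simp only [map_sub, map_mul, map_ofNat]
    field_simp
    ring
  refine ⟨w + RatFunc.C (4 * β - 4) * D⁻¹, ?_, hm⟩
  rw [isRationalSolution_iff_auxOne, hm, ← hD, eq_sub_of_add_eq h]
  simp only [map_sub, map_mul, map_ofNat]
  field_simp
  ring

/-- Same mechanism: 2wf + f² + f' = 0 with f = c/D forces c = D' - 2wD = 1 + 2β. -/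
theorem exists_solution_neg_one_sub {β : ℂ} {w : RatFunc ℂ} (hw : IsRationalSolution β w)
    (hβ : 1 + 2 * β ≠ 0) :
    ∃ w', IsRationalSolution (-1 - β) w' ∧ miuraTwo w' = miuraTwo w := by
  have h := (isRationalSolution_iff_auxTwo β w).1 hw
  set D := auxTwo (miuraTwo w) with hD
  have hD0 : D ≠ 0 := by
    intro h0
    rw [h0, ratDeriv_zero, mul_zero, sub_zero, eq_comm, map_eq_zero] at h
    exact hβ h
  have hm : miuraTwo (w + RatFunc.C (1 + 2 * β) * D⁻¹) = miuraTwo w := by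
    unfold miuraTwo
    rw [ratDeriv_add, ratDeriv_C_mul, ratDeriv_inv hD0, eq_add_of_sub_eq h]
    simp only [map_add, map_mul, map_ofNat, map_one]
    field_simp
    ring
  refine ⟨w + RatFunc.C (1 + 2 * β) * D⁻¹, ?_, hm⟩
  rw [isRationalSolution_iff_auxTwo, hm, ← hD, eq_add_of_sub_eq h]
  simp only [map_sub, map_add, map_neg, map_mul, map_ofNat, map_one]
  field_simp
  ring

/-! ### Behaviour at infinity -/

/-- The rational functions of degree at most `k` at infinity. -/
def degLE (k : ℤ) : AddSubgroup (RatFunc ℂ) where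
  carrier := {f | f ≠ 0 → f.intDegree ≤ k}
  zero_mem' := fun h => absurd rfl h
  neg_mem' := fun {f} hf h => by
    rw [RatFunc.intDegree_neg]
    exact hf (neg_ne_zero.1 h)
  add_mem' := fun {f g} hf hg h => by
    by_cases hg0 : g = 0
    · subst hg0
      rw [add_zero] at h ⊢
      exact hf h
    by_cases hf0 : f = 0
    · subst hf0
      rw [zero_add] at h ⊢
      exact hg h
    exact (RatFunc.intDegree_add_le hg0 h).trans (max_le (hf hf0) (hg hg0))

theorem degLE_mono {j k : ℤ} (h : j ≤ k) {f : RatFunc ℂ} (hf : f ∈ degLE j) : f ∈ degLE k :=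
  fun h0 => (hf h0).trans h

theorem mul_mem_degLE {j k l : ℤ} {f g : RatFunc ℂ} (hf : f ∈ degLE j) (hg : g ∈ degLE k)
    (h : j + k ≤ l) : f * g ∈ degLE l := by
  intro h0
  have hf0 := left_ne_zero_of_mul h0
  have hg0 := right_ne_zero_of_mul h0
  rw [RatFunc.intDegree_mul hf0 hg0]
  linarith [hf hf0, hg hg0]

theorem C_mem_degLE (a : ℂ) : RatFunc.C a ∈ degLE 0 := fun _ => (RatFunc.intDegree_C a).le

theorem X_mem_degLE : RatFunc.X ∈ degLE 1 := fun _ => RatFunc.intDegree_X.le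

theorem ofNat_mem_degLE (n : ℕ) [n.AtLeastTwo] : (OfNat.ofNat n : RatFunc ℂ) ∈ degLE 0 := by
  rw [← map_ofNat (RatFunc.C (K := ℂ)) n]
  exact C_mem_degLE _

theorem pow_mem_degLE {k : ℤ} {f : RatFunc ℂ} (hf : f ∈ degLE k) (n : ℕ) :
    f ^ n ∈ degLE (n * k) := by
  induction n with
  | zero => simpa using C_mem_degLE 1
  | succ n ih =>
    rw [pow_succ]
    refine mul_mem_degLE ih hf ?_
    push_cast
    linarith

theorem div_mem_degLE {p q : ℂ[X]} (hq : q ≠ 0) {k : ℤ}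
    (h : (p.natDegree : ℤ) - q.natDegree ≤ k) :
    algebraMap ℂ[X] (RatFunc ℂ) p / algebraMap ℂ[X] (RatFunc ℂ) q ∈ degLE k := by
  intro h0
  have hp : algebraMap ℂ[X] (RatFunc ℂ) p ≠ 0 := (div_ne_zero_iff.1 h0).1
  rw [RatFunc.intDegree_div hp (RatFunc.algebraMap_ne_zero hq), RatFunc.intDegree_polynomial,
    RatFunc.intDegree_polynomial]
  exact h

theorem ratDeriv_mem_degLE {k : ℤ} {f : RatFunc ℂ} (hf : f ∈ degLE k) :
    ratDeriv f ∈ degLE (k - 1) := by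
  by_cases hf0 : f = 0
  · rw [hf0, ratDeriv_zero]
    exact zero_mem _
  have hk := hf hf0
  rw [RatFunc.intDegree] at hk
  have hn : f.num ≠ 0 := RatFunc.num_ne_zero hf0
  rw [ratDeriv, ← map_pow]
  -- Constants are set apart: truncated degrees cannot record the drop below zero.
  by_cases hd : f.num.natDegree + f.denom.natDegree = 0
  · rw [Nat.add_eq_zero_iff] at hd
    rw [derivative_of_natDegree_zero hd.1, derivative_of_natDegree_zero hd.2]
    simp
  refine div_mem_degLE (pow_ne_zero 2 f.denom_ne_zero) ?_
  have h1 : (derivative f.num * f.denom - f.num * derivative f.denom).natDegree + 1 ≤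
      f.num.natDegree + f.denom.natDegree := by
    have a1 : (derivative f.num * f.denom).natDegree + 1 ≤
        f.num.natDegree + f.denom.natDegree := by
      by_cases h : f.num.natDegree = 0
      · rw [derivative_of_natDegree_zero h, zero_mul, natDegree_zero]
        omega
      · have := natDegree_derivative_lt h
        have := natDegree_mul_le (p := derivative f.num) (q := f.denom)
        omega
    have a2 : (f.num * derivative f.denom).natDegree + 1 ≤
        f.num.natDegree + f.denom.natDegree := by
      by_cases h : f.denom.natDegree = 0
      · rw [derivative_of_natDegree_zero h, mul_zero, natDegree_zero]
        omega
      · have := natDegree_derivative_lt h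
        have := natDegree_mul_le (p := f.num) (q := derivative f.denom)
        omega
    have := natDegree_sub_le (derivative f.num * f.denom) (f.num * derivative f.denom)
    omega
  rw [natDegree_pow]
  push_cast
  omega

theorem eq_zero_of_C_mem_degLE {a : ℂ} (h : RatFunc.C a ∈ degLE (-1)) : a = 0 := by
  by_contra ha
  have := h (by rwa [Ne, map_eq_zero])
  rw [RatFunc.intDegree_C] at this
  omega

/-- For a reduced fraction p/q, the relation p'q = pq' gives q ∣ q', so q' = 0 and then p' = 0; a
constant that decays is zero. -/
theorem eq_zero_of_ratDeriv_eq_zero {f : RatFunc ℂ} (hf : f ∈ degLE (-1))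
    (h : ratDeriv f = 0) : f = 0 := by
  have hd := f.denom_ne_zero
  rw [ratDeriv, div_eq_zero_iff, or_iff_left (pow_ne_zero 2 (RatFunc.algebraMap_ne_zero hd)),
    map_eq_zero_iff _ (RatFunc.algebraMap_injective ℂ), sub_eq_zero] at h
  have hdvd : f.denom ∣ derivative f.denom :=
    f.isCoprime_num_denom.symm.dvd_of_dvd_mul_left ⟨derivative f.num, by rw [← h, mul_comm]⟩
  have h1 : derivative f.denom = 0 := by
    by_contra hne
    have h2 := natDegree_le_of_dvd hdvd hne
    have h3 : f.denom.natDegree ≠ 0 := fun h3 => hne (derivative_of_natDegree_zero h3)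
    exact absurd (natDegree_derivative_lt h3) (not_lt.2 h2)
  rw [h1, mul_zero, mul_eq_zero, or_iff_left hd] at h
  have h2 := derivative_eq_zero.1 h
  have h3 := derivative_eq_zero.1 h1
  by_contra hne
  have := hf hne
  rw [RatFunc.intDegree, h2, h3] at this
  omega

/-- Dominant balance: if w had degree m ≥ 1, the term w⁵ would outgrow all others; if m = 0, the
term zw would. -/
theorem solution_mem_degLE {β : ℂ} {w : RatFunc ℂ} (hw : IsRationalSolution β w) :
    w ∈ degLE (-1) := by
  intro hw0
  by_contra! hdeg
  set m := w.intDegree with hm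
  have h0 : w ∈ degLE m := fun _ => le_rfl
  have h1 := ratDeriv_mem_degLE h0
  have h2 := ratDeriv_mem_degLE h1
  have h3 := ratDeriv_mem_degLE h2
  have h4 := ratDeriv_mem_degLE h3
  have h5 := ofNat_mem_degLE 5
  simp only [IsRationalSolution, Function.iterate_succ, Function.iterate_zero,
    Function.comp_apply, id_eq] at hw
  have hlow : ∀ k : ℤ, m ≤ k + 3 → 0 ≤ k → 2 * m ≤ k + 2 → 3 * m ≤ k + 2 →
      ratDeriv (ratDeriv (ratDeriv (ratDeriv w))) + 5 * ratDeriv w * ratDeriv (ratDeriv w)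
        - 5 * w ^ 2 * ratDeriv (ratDeriv w) - 5 * w * ratDeriv w ^ 2 - RatFunc.C β
        ∈ degLE k := by
    intro k k2 k3 k4 k5
    refine sub_mem (sub_mem (sub_mem (add_mem (degLE_mono (by omega) h4) ?_) ?_) ?_)
      (degLE_mono k3 (C_mem_degLE β))
    · exact mul_mem_degLE (mul_mem_degLE h5 h1 le_rfl) h2 (by omega)
    · exact mul_mem_degLE (mul_mem_degLE h5 (pow_mem_degLE h0 2) le_rfl) h2
        (by push_cast; omega)
    · exact mul_mem_degLE (mul_mem_degLE h5 h0 le_rfl) (pow_mem_degLE h1 2)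
        (by push_cast; omega)
  rcases (show m = 0 ∨ 1 ≤ m by omega) with hm0 | hm1
  · have hX : RatFunc.X * w ∈ degLE 0 := by
      have e : RatFunc.X * w = (ratDeriv (ratDeriv (ratDeriv (ratDeriv w)))
          + 5 * ratDeriv w * ratDeriv (ratDeriv w)
          - 5 * w ^ 2 * ratDeriv (ratDeriv w) - 5 * w * ratDeriv w ^ 2 - RatFunc.C β) + w ^ 5 := by
        linear_combination -hw
      rw [e]
      refine add_mem (hlow 0 ?_ ?_ ?_ ?_) (degLE_mono ?_ (pow_mem_degLE h0 5)) <;> omega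
    have := hX (mul_ne_zero RatFunc.X_ne_zero hw0)
    rw [RatFunc.intDegree_mul RatFunc.X_ne_zero hw0, RatFunc.intDegree_X] at this
    omega
  · have hX : w ^ 5 ∈ degLE (5 * m - 1) := by
      have e : w ^ 5 = RatFunc.X * w - (ratDeriv (ratDeriv (ratDeriv (ratDeriv w)))
          + 5 * ratDeriv w * ratDeriv (ratDeriv w)
          - 5 * w ^ 2 * ratDeriv (ratDeriv w) - 5 * w * ratDeriv w ^ 2 - RatFunc.C β) := by
        linear_combination hw
      rw [e]
      refine sub_mem (mul_mem_degLE X_mem_degLE h0 ?_) (hlow _ ?_ ?_ ?_ ?_) <;> omega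
    have := hX (pow_ne_zero 5 hw0)
    have e5 : (w ^ 5).intDegree = 5 * m := by
      rw [show w ^ 5 = w * w * w * w * w by ring]
      rw [RatFunc.intDegree_mul (by simp [hw0]) hw0, RatFunc.intDegree_mul (by simp [hw0]) hw0,
        RatFunc.intDegree_mul (by simp [hw0]) hw0, RatFunc.intDegree_mul hw0 hw0]
      omega
    omega

/-- Gives w ~ -β/z, which ties β to the degrees of the tau functions. -/
theorem X_mul_solution_add_mem_degLE {β : ℂ} {w : RatFunc ℂ} (hw : IsRationalSolution β w) :
    RatFunc.X * w + RatFunc.C β ∈ degLE (-1) := by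
  have h0 := solution_mem_degLE hw
  have h1 := ratDeriv_mem_degLE h0
  have h2 := ratDeriv_mem_degLE h1
  have h3 := ratDeriv_mem_degLE h2
  have h4 := ratDeriv_mem_degLE h3
  have h5 := ofNat_mem_degLE 5
  simp only [IsRationalSolution, Function.iterate_succ, Function.iterate_zero,
    Function.comp_apply, id_eq] at hw
  have e : RatFunc.X * w + RatFunc.C β = ratDeriv (ratDeriv (ratDeriv (ratDeriv w)))
      + 5 * ratDeriv w * ratDeriv (ratDeriv w)
      - 5 * w ^ 2 * ratDeriv (ratDeriv w) - 5 * w * ratDeriv w ^ 2 + w ^ 5 := by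
    linear_combination -hw
  rw [e]
  refine add_mem (sub_mem (sub_mem (add_mem (degLE_mono (by omega) h4) ?_) ?_) ?_)
    (degLE_mono (by norm_num) (pow_mem_degLE h0 5))
  · exact mul_mem_degLE (mul_mem_degLE h5 h1 le_rfl) h2 (by omega)
  · exact mul_mem_degLE (mul_mem_degLE h5 (pow_mem_degLE h0 2) le_rfl) h2 (by norm_num)
  · exact mul_mem_degLE (mul_mem_degLE h5 h0 le_rfl) (pow_mem_degLE h1 2) (by norm_num)

theorem solution_unique {β : ℂ} {v w : RatFunc ℂ} (hv : IsRationalSolution β v)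
    (hw : IsRationalSolution β w) : v = w := by
  by_contra hne
  have hd0 : v - w ≠ 0 := sub_ne_zero.2 hne
  have v0 := solution_mem_degLE hv
  have v1 := ratDeriv_mem_degLE v0
  have v2 := ratDeriv_mem_degLE v1
  have w0 := solution_mem_degLE hw
  have w1 := ratDeriv_mem_degLE w0
  have w2 := ratDeriv_mem_degLE w1
  have h5 := ofNat_mem_degLE 5
  have d0 : v - w ∈ degLE (v - w).intDegree := fun _ => le_rfl
  set m := (v - w).intDegree with hm
  have d1 := ratDeriv_mem_degLE d0
  have d2 := ratDeriv_mem_degLE d1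
  have d4 := ratDeriv_mem_degLE (ratDeriv_mem_degLE d2)
  simp only [IsRationalSolution, Function.iterate_succ, Function.iterate_zero,
    Function.comp_apply, id_eq] at hv hw
  -- Every term on the right is linear in v - w or one of its derivatives, with coefficients bounded
  -- at infinity. So multiplication by z would not raise the degree of v - w.
  have e : RatFunc.X * (v - w) =
      ratDeriv (ratDeriv (ratDeriv (ratDeriv (v - w))))
      + 5 * (ratDeriv (v - w) * ratDeriv (ratDeriv v) + ratDeriv w * ratDeriv (ratDeriv (v - w)))
      - 5 * ((v - w) * ((v + w) * ratDeriv (ratDeriv v)) + w ^ 2 * ratDeriv (ratDeriv (v - w)))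
      - 5 * ((v - w) * ratDeriv v ^ 2 + ratDeriv (v - w) * (w * (ratDeriv v + ratDeriv w)))
      + (v - w) * (v ^ 4 + v ^ 3 * w + v ^ 2 * w ^ 2 + v * w ^ 3 + w ^ 4) := by
    simp only [ratDeriv_sub]
    linear_combination hw - hv
  have hX : RatFunc.X * (v - w) ∈ degLE m := by
    rw [e]
    refine add_mem (sub_mem (sub_mem (add_mem (degLE_mono (by omega) d4) ?_) ?_) ?_) ?_
    · refine mul_mem_degLE h5 (add_mem (mul_mem_degLE d1 v2 ?_) (mul_mem_degLE w1 d2 ?_))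
        (zero_add m).le <;> omega
    · refine mul_mem_degLE h5 (add_mem
        (mul_mem_degLE d0 (mul_mem_degLE (add_mem v0 w0) v2 le_rfl) ?_)
        (mul_mem_degLE (pow_mem_degLE w0 2) d2 ?_)) (zero_add m).le <;> push_cast <;> omega
    · refine mul_mem_degLE h5 (add_mem (mul_mem_degLE d0 (pow_mem_degLE v1 2) ?_)
        (mul_mem_degLE d1 (mul_mem_degLE w0 (add_mem v1 w1) le_rfl) ?_)) (zero_add m).le <;>
        push_cast <;> omega
    · refine mul_mem_degLE d0 (k := 0) ?_ (by omega)
      have p := fun n => degLE_mono (k := 0) (by simp) (pow_mem_degLE v0 n)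
      have q := fun n => degLE_mono (k := 0) (by simp) (pow_mem_degLE w0 n)
      have v0' := degLE_mono (k := 0) (by omega) v0
      have w0' := degLE_mono (k := 0) (by omega) w0
      exact add_mem (add_mem (add_mem (add_mem (p 4) (mul_mem_degLE (p 3) w0' le_rfl))
        (mul_mem_degLE (p 2) (q 2) le_rfl)) (mul_mem_degLE v0' (q 3) le_rfl)) (q 4)
  have := hX (mul_ne_zero RatFunc.X_ne_zero hd0)
  rw [RatFunc.intDegree_mul RatFunc.X_ne_zero hd0, RatFunc.intDegree_X] at this
  omega

/-! ### Behaviour at a finite point -/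

/-- The local ring of rational functions regular at `c`. -/
def regularAt (c : ℂ) : Subring (RatFunc ℂ) where
  carrier := {f | ∃ p q : ℂ[X], q.eval c ≠ 0 ∧
    f = algebraMap ℂ[X] (RatFunc ℂ) p / algebraMap ℂ[X] (RatFunc ℂ) q}
  zero_mem' := ⟨0, 1, by simp, by simp⟩
  one_mem' := ⟨1, 1, by simp, by simp⟩
  neg_mem' := by
    rintro _ ⟨p, q, hq, rfl⟩
    exact ⟨-p, q, hq, by rw [map_neg, ← neg_div]⟩
  add_mem' := by
    rintro _ _ ⟨p, q, hq, rfl⟩ ⟨r, s, hs, rfl⟩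
    have hq' : q ≠ 0 := by rintro rfl; simp at hq
    have hs' : s ≠ 0 := by rintro rfl; simp at hs
    refine ⟨p * s + q * r, q * s, by simpa using ⟨hq, hs⟩, ?_⟩
    rw [div_add_div _ _ (RatFunc.algebraMap_ne_zero hq') (RatFunc.algebraMap_ne_zero hs')]
    simp
  mul_mem' := by
    rintro _ _ ⟨p, q, hq, rfl⟩ ⟨r, s, hs, rfl⟩
    exact ⟨p * r, q * s, by simpa using ⟨hq, hs⟩, by rw [div_mul_div_comm, map_mul, map_mul]⟩

/-- The local parameter `z - c`. -/
def linear (c : ℂ) : RatFunc ℂ := algebraMap ℂ[X] (RatFunc ℂ) (X - C c)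

theorem linear_ne_zero (c : ℂ) : linear c ≠ 0 := RatFunc.algebraMap_ne_zero (X_sub_C_ne_zero c)

theorem ratDeriv_linear (c : ℂ) : ratDeriv (linear c) = 1 := by
  rw [linear, ratDeriv_algebraMap, derivative_X_sub_C, map_one]

theorem algebraMap_mem_regularAt (c : ℂ) (p : ℂ[X]) :
    algebraMap ℂ[X] (RatFunc ℂ) p ∈ regularAt c := ⟨p, 1, by simp, by simp⟩

theorem linear_mem_regularAt (b c : ℂ) : linear b ∈ regularAt c := algebraMap_mem_regularAt c _

theorem C_mem_regularAt (a c : ℂ) : RatFunc.C a ∈ regularAt c := by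
  rw [← RatFunc.algebraMap_C]
  exact algebraMap_mem_regularAt c _

theorem X_mem_regularAt (c : ℂ) : RatFunc.X ∈ regularAt c := by
  rw [← RatFunc.algebraMap_X]
  exact algebraMap_mem_regularAt c _

theorem linear_inv_mem_regularAt {b c : ℂ} (h : c ≠ b) : (linear b)⁻¹ ∈ regularAt c :=
  ⟨1, X - C b, by simpa using sub_ne_zero.2 h, by rw [map_one, one_div, linear]⟩

theorem ratDeriv_mem_regularAt {c : ℂ} {f : RatFunc ℂ} (hf : f ∈ regularAt c) :
    ratDeriv f ∈ regularAt c := by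
  obtain ⟨p, q, hq, rfl⟩ := hf
  have hq' : q ≠ 0 := by rintro rfl; simp at hq
  rw [ratDeriv_div p q hq', ← map_pow]
  exact ⟨_, q ^ 2, by simpa using hq, rfl⟩

theorem exists_eq_C_add_linear_mul {c : ℂ} {f : RatFunc ℂ} (hf : f ∈ regularAt c) :
    ∃ a : ℂ, ∃ g ∈ regularAt c, f = RatFunc.C a + linear c * g := by
  obtain ⟨p, q, hq, rfl⟩ := hf
  have hq' : q ≠ 0 := by rintro rfl; simp at hq
  obtain ⟨r, hr⟩ : X - C c ∣ p - C (p.eval c / q.eval c) * q := by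
    rw [dvd_iff_isRoot]
    simp [hq]
  refine ⟨p.eval c / q.eval c, _, ⟨r, q, hq, rfl⟩, ?_⟩
  have hq'' := RatFunc.algebraMap_ne_zero (K := ℂ) hq'
  rw [← mul_div_assoc, linear, ← map_mul, ← hr, ← RatFunc.algebraMap_C, map_sub, map_mul]
  field_simp
  ring

theorem eq_zero_of_C_eq_linear_mul {a c : ℂ} {g : RatFunc ℂ} (hg : g ∈ regularAt c)
    (h : RatFunc.C a = linear c * g) : a = 0 := by
  obtain ⟨p, q, hq, rfl⟩ := hg
  have hq' : q ≠ 0 := by rintro rfl; simp at hq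
  rw [← mul_div_assoc, eq_div_iff (RatFunc.algebraMap_ne_zero hq'), linear, ← map_mul,
    ← RatFunc.algebraMap_C, ← map_mul] at h
  have := congrArg (eval c) (RatFunc.algebraMap_injective ℂ h)
  simpa [hq] using this

theorem exists_linear_pow_mul_mem_regularAt (c : ℂ) (f : RatFunc ℂ) :
    ∃ m : ℕ, linear c ^ m * f ∈ regularAt c := by
  obtain ⟨p, q, hq, rfl⟩ := exists_eq_div f
  obtain ⟨r, hr, hdvd⟩ := exists_eq_pow_rootMultiplicity_mul_and_not_dvd q hq c
  rw [dvd_iff_isRoot] at hdvd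
  refine ⟨q.rootMultiplicity c, p, r, hdvd, ?_⟩
  have hr0 : r ≠ 0 := by rintro rfl; simp at hdvd
  have hr' := RatFunc.algebraMap_ne_zero (K := ℂ) hr0
  have hl := linear_ne_zero c
  have e := congrArg (algebraMap ℂ[X] (RatFunc ℂ)) hr
  rw [map_mul, map_pow, ← linear] at e
  rw [e]
  field_simp

/-- Liouville's theorem in rational form: a nonconstant denominator has a root, which would be a
pole. -/
theorem eq_zero_of_forall_regularAt {f : RatFunc ℂ} (hf : ∀ c, f ∈ regularAt c)
    (hdeg : f ∈ degLE (-1)) : f = 0 := by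
  by_contra h0
  have h1 := hdeg h0
  have hd : f.denom.degree = 0 := by
    by_contra hne
    obtain ⟨c, hc⟩ := IsAlgClosed.exists_root f.denom hne
    obtain ⟨p, q, hq, hpq⟩ := hf c
    have hdvd : f.denom ∣ q := hpq ▸ RatFunc.denom_div_dvd p q
    exact hq (eval_eq_zero_of_dvd_of_eval_eq_zero hdvd hc)
  rw [RatFunc.intDegree, natDegree_eq_zero_iff_degree_le_zero.2 hd.le] at h1
  omega

theorem linear_mul_ratDeriv_pow (c : ℂ) (n : ℕ) :
    linear c * ratDeriv (linear c ^ n) = n * linear c ^ n := by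
  induction n with
  | zero => simp [ratDeriv_one]
  | succ n ih =>
    rw [pow_succ, ratDeriv_mul, ratDeriv_linear]
    push_cast
    linear_combination linear c * ih

theorem linear_pow_mul_ratDeriv_mem {c : ℂ} {f : RatFunc ℂ} {n : ℕ}
    (hf : linear c ^ n * f ∈ regularAt c) : linear c ^ (n + 1) * ratDeriv f ∈ regularAt c := by
  have e : linear c ^ (n + 1) * ratDeriv f =
      linear c * ratDeriv (linear c ^ n * f) - n * (linear c ^ n * f) := by
    rw [ratDeriv_mul]
    linear_combination -f * linear_mul_ratDeriv_pow c n
  rw [e]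
  exact sub_mem (mul_mem (linear_mem_regularAt c c) (ratDeriv_mem_regularAt hf))
    (mul_mem (natCast_mem _ n) hf)

theorem exists_add_mul_pow_five {S : Subring (RatFunc ℂ)} {t a s : RatFunc ℂ} (ht : t ∈ S)
    (ha : a ∈ S) (hs : s ∈ S) : ∃ k ∈ S, (a + t * s) ^ 5 = a ^ 5 + t * k := by
  lift t to S using ht
  lift a to S using ha
  lift s to S using hs
  have h5 : ((5 : S) : RatFunc ℂ) = 5 := rfl
  have h10 : ((10 : S) : RatFunc ℂ) = 10 := rfl
  exact ⟨_, (5 * a ^ 4 * s + 10 * a ^ 3 * s ^ 2 * t + 10 * a ^ 2 * s ^ 3 * t ^ 2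
      + 5 * a * s ^ 4 * t ^ 3 + s ^ 5 * t ^ 4).2, by
        push_cast [h5, h10]; ring⟩

/-- The Laurent expansion of the left-hand side of the equation at a simple pole, up to two
orders beyond the leading one. -/
theorem exists_laurent_expansion {S : Subring (RatFunc ℂ)} {t a b z s s1 s2 s4 : RatFunc ℂ}
    (ht0 : t ≠ 0) (ht : t ∈ S) (ha : a ∈ S) (hb : b ∈ S) (hz : z ∈ S) (hs : s ∈ S)
    (hs1 : s1 ∈ S) (hs2 : s2 ∈ S) (hs4 : s4 ∈ S) :
    ∃ k ∈ S, t ^ 5 * ((24 * a * t⁻¹ ^ 5 + s4)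
        + 5 * (-a * t⁻¹ ^ 2 + s1) * (2 * a * t⁻¹ ^ 3 + s2)
        - 5 * (a * t⁻¹ + s) ^ 2 * (2 * a * t⁻¹ ^ 3 + s2)
        - 5 * (a * t⁻¹ + s) * (-a * t⁻¹ ^ 2 + s1) ^ 2 + (a * t⁻¹ + s) ^ 5
        - z * (a * t⁻¹ + s) - b) =
      a ^ 5 - 15 * a ^ 3 - 10 * a ^ 2 + 24 * a + t * ((5 * a ^ 4 - 25 * a ^ 2) * s)
        + t ^ 2 * k := by
  lift t to S using ht
  lift a to S using ha
  lift b to S using hb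
  lift z to S using hz
  lift s to S using hs
  lift s1 to S using hs1
  lift s2 to S using hs2
  lift s4 to S using hs4
  have h5 : ((5 : S) : RatFunc ℂ) = 5 := rfl
  have h10 : ((10 : S) : RatFunc ℂ) = 10 := rfl
  refine ⟨_, (t ^ 3 * s4 + (10 * a * s1 - 5 * a * t * s2 + 5 * t ^ 3 * s1 * s2)
    - (10 * a * s ^ 2 + 5 * t * s2 * (a + t * s) ^ 2)
    + (10 * a * s1 * (a + t * s) - 5 * t ^ 2 * s1 ^ 2 * (a + t * s))
    + (10 * a ^ 3 * s ^ 2 + 10 * a ^ 2 * t * s ^ 3 + 5 * a * t ^ 2 * s ^ 4 + t ^ 3 * s ^ 5)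
    - z * t ^ 2 * (a + t * s) - b * t ^ 3).2, ?_⟩
  push_cast [h5, h10]
  field_simp
  ring

/-- At a pole of order m ≥ 2, w⁵ has order 5m, while every other term has order strictly less. -/
theorem linear_mul_solution_mem {β : ℂ} {w : RatFunc ℂ} (hw : IsRationalSolution β w) (c : ℂ) :
    linear c * w ∈ regularAt c := by
  classical
  have hex := exists_linear_pow_mul_mem_regularAt c w
  have hmem := Nat.find_spec hex
  have hmin := fun m => Nat.find_min (m := m) hex
  set t := linear c with ht
  have htm : t ∈ regularAt c := linear_mem_regularAt c c
  generalize Nat.find hex = m at hmem hmin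
  rcases m with _ | _ | n
  · exact mul_mem htm (by simpa using hmem)
  · simpa using hmem
  exfalso
  obtain ⟨a, h, hh, hg⟩ := exists_eq_C_add_linear_mul hmem
  rw [← ht] at hg
  have h0 := hmem
  have h1 := linear_pow_mul_ratDeriv_mem h0
  have h2 := linear_pow_mul_ratDeriv_mem h1
  have h4 := linear_pow_mul_ratDeriv_mem (linear_pow_mul_ratDeriv_mem h2)
  have h5 : (5 : RatFunc ℂ) ∈ regularAt c := ofNat_mem _ 5
  rw [← ht] at h1 h2 h4
  simp only [IsRationalSolution, Function.iterate_succ, Function.iterate_zero,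
    Function.comp_apply, id_eq] at hw
  -- The pole order is n + 2, so the exponent is one less than the order 5(n + 2) of w⁵.
  have hlow : t ^ (5 * n + 9) * w ^ 5 ∈ regularAt c := by
    have e : t ^ (5 * n + 9) * w ^ 5 =
        t ^ (4 * n + 7) * RatFunc.X * (t ^ (n + 1 + 1) * w) + t ^ (5 * n + 9) * RatFunc.C β
        - t ^ (4 * n + 3) *
          (t ^ (n + 1 + 1 + 1 + 1 + 1 + 1) * ratDeriv (ratDeriv (ratDeriv (ratDeriv w))))
        - 5 * t ^ (3 * n + 2) * (t ^ (n + 1 + 1 + 1) * ratDeriv w)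
          * (t ^ (n + 1 + 1 + 1 + 1) * ratDeriv (ratDeriv w))
        + 5 * t ^ (2 * n + 1) * (t ^ (n + 1 + 1) * w) ^ 2
          * (t ^ (n + 1 + 1 + 1 + 1) * ratDeriv (ratDeriv w))
        + 5 * t ^ (2 * n + 1) * (t ^ (n + 1 + 1) * w)
          * (t ^ (n + 1 + 1 + 1) * ratDeriv w) ^ 2 := by
      linear_combination t ^ (5 * n + 9) * hw
    rw [e]
    have hp := fun k => pow_mem htm k
    exact add_mem (add_mem (sub_mem (sub_mem (add_mem
      (mul_mem (mul_mem (hp _) (X_mem_regularAt c)) h0)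
      (mul_mem (hp _) (C_mem_regularAt β c))) (mul_mem (hp _) h4))
      (mul_mem (mul_mem (mul_mem h5 (hp _)) h1) h2))
      (mul_mem (mul_mem (mul_mem h5 (hp _)) (pow_mem h0 2)) h2))
      (mul_mem (mul_mem (mul_mem h5 (hp _)) h0) (pow_mem h1 2))
  obtain ⟨k, hk, hgk⟩ : ∃ k ∈ regularAt c, (RatFunc.C a + t * h) ^ 5 = RatFunc.C (a ^ 5) + t * k := by
    rw [map_pow]
    exact exists_add_mul_pow_five htm (C_mem_regularAt a c) hh
  have ha : a ^ 5 = 0 := by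
    refine eq_zero_of_C_eq_linear_mul (sub_mem hlow hk) ?_
    rw [← hg] at hgk
    rw [← ht]
    linear_combination -hgk
  rw [pow_eq_zero_iff (by norm_num)] at ha
  -- The leading coefficient vanishes, so a smaller power of t already clears the pole.
  refine hmin (n + 1) (by omega) ?_
  rw [ha, map_zero, zero_add, pow_succ t (n + 1), mul_comm _ t, mul_assoc] at hg
  rw [mul_left_cancel₀ (linear_ne_zero c) hg]
  exact hh

/-- A solution has at most a simple pole at `c`; its residue is one of `1, -2, -3, 4`, and the
constant term of its Laurent expansion vanishes. -/
theorem exists_residue {β : ℂ} {w : RatFunc ℂ} (hw : IsRationalSolution β w) (c : ℂ) :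
    ∃ a : ℤ, (a = 0 ∨ a = 1 ∨ a = -2 ∨ a = -3 ∨ a = 4) ∧
      w - a * (linear c)⁻¹ ∈ regularAt c ∧ w ^ 2 - (a * (linear c)⁻¹) ^ 2 ∈ regularAt c := by
  obtain ⟨a, s, hs, hg⟩ := exists_eq_C_add_linear_mul (linear_mul_solution_mem hw c)
  obtain ⟨b, h, hh, hsb⟩ := exists_eq_C_add_linear_mul hs
  have htm : linear c ∈ regularAt c := linear_mem_regularAt c c
  have ht0 := linear_ne_zero c
  have ht1 := ratDeriv_linear c
  set t := linear c with ht
  have k1 := ratDeriv_mem_regularAt hs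
  have k2 := ratDeriv_mem_regularAt k1
  have k4 := ratDeriv_mem_regularAt (ratDeriv_mem_regularAt k2)
  have w0 : w = RatFunc.C a * t⁻¹ + s := by
    field_simp
    linear_combination hg
  have hti : ratDeriv t⁻¹ = -(t⁻¹) ^ 2 := by
    rw [ratDeriv_inv ht0, ht1]
    field_simp
  have w1 : ratDeriv w = -RatFunc.C a * (t⁻¹) ^ 2 + ratDeriv s := by
    rw [w0, ratDeriv_add, ratDeriv_C_mul, hti]
    ring
  have w2 : ratDeriv (ratDeriv w) = 2 * RatFunc.C a * (t⁻¹) ^ 3 + ratDeriv (ratDeriv s) := by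
    rw [w1, ratDeriv_add, ratDeriv_mul, ratDeriv_neg, ratDeriv_C, ratDeriv_sq, hti]
    ring
  have w3 : ratDeriv (ratDeriv (ratDeriv w)) =
      -6 * RatFunc.C a * (t⁻¹) ^ 4 + ratDeriv (ratDeriv (ratDeriv s)) := by
    rw [w2, ratDeriv_add, pow_succ _ 2]
    simp only [ratDeriv_mul, ratDeriv_ofNat, ratDeriv_C, ratDeriv_sq, hti]
    ring
  have w4 : ratDeriv (ratDeriv (ratDeriv (ratDeriv w))) =
      24 * RatFunc.C a * (t⁻¹) ^ 5 + ratDeriv (ratDeriv (ratDeriv (ratDeriv s))) := by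
    rw [w3, ratDeriv_add, pow_succ _ 3, pow_succ _ 2]
    simp only [ratDeriv_mul, ratDeriv_neg, ratDeriv_ofNat, ratDeriv_C, ratDeriv_sq, hti]
    ring
  have key : ∃ k ∈ regularAt c, RatFunc.C (a ^ 5 - 15 * a ^ 3 - 10 * a ^ 2 + 24 * a)
      + t * (RatFunc.C (5 * a ^ 4 - 25 * a ^ 2) * s) + t ^ 2 * k = 0 := by
    simp only [IsRationalSolution, Function.iterate_succ, Function.iterate_zero,
      Function.comp_apply, id_eq] at hw
    rw [w4, w2, w1, w0] at hw
    simp only [map_add, map_sub, map_mul, map_pow, map_ofNat]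
    obtain ⟨k, hk, e⟩ := exists_laurent_expansion ht0 htm (C_mem_regularAt a c)
      (C_mem_regularAt β c) (X_mem_regularAt c) hs k1 k2 k4
    exact ⟨k, hk, by rw [← e, hw, mul_zero]⟩
  obtain ⟨k, hk, hkey⟩ := key
  have ha : a ^ 5 - 15 * a ^ 3 - 10 * a ^ 2 + 24 * a = 0 := by
    refine eq_zero_of_C_eq_linear_mul (c := c) (neg_mem (add_mem
      (mul_mem (C_mem_regularAt (5 * a ^ 4 - 25 * a ^ 2) c) hs) (mul_mem htm hk))) ?_
    rw [← ht]
    linear_combination hkey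
  -- The next Laurent coefficient; b is the constant term of w at c. The factor 5a⁴ - 25a² is
  -- nonzero at each nonzero admissible residue.
  have hab : (5 * a ^ 4 - 25 * a ^ 2) * b = 0 := by
    rw [ha, map_zero, zero_add, sq t, mul_assoc, ← mul_add, mul_eq_zero, or_iff_right ht0] at hkey
    refine eq_zero_of_C_eq_linear_mul (c := c) (neg_mem (add_mem
      (mul_mem (C_mem_regularAt (5 * a ^ 4 - 25 * a ^ 2) c) hh) hk)) ?_
    rw [map_mul, ← ht]
    rw [hsb] at hkey
    linear_combination hkey
  have hroots : a = 0 ∨ a = 1 ∨ a = -2 ∨ a = -3 ∨ a = 4 := by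
    have : a * ((a - 1) * ((a + 2) * ((a + 3) * (a - 4)))) = 0 := by linear_combination ha
    simpa only [mul_eq_zero, sub_eq_zero, add_eq_zero_iff_eq_neg] using this
  have hab' : a * b = 0 := by
    rcases hroots with h | h | h | h | h <;> rw [h] at hab ⊢ <;> norm_num at hab ⊢ <;> exact hab
  obtain ⟨n, hn, rfl⟩ : ∃ n : ℤ, (n = 0 ∨ n = 1 ∨ n = -2 ∨ n = -3 ∨ n = 4) ∧ a = n := by
    rcases hroots with h | h | h | h | h
    exacts [⟨0, by simp, by simp [h]⟩, ⟨1, by simp, by simp [h]⟩, ⟨-2, by simp, by simp [h]⟩,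
      ⟨-3, by simp, by simp [h]⟩, ⟨4, by simp, by simp [h]⟩]
  rw [map_intCast] at w0
  have e1 : w - n * t⁻¹ = s := by rw [w0, add_sub_cancel_left]
  have e2 : w ^ 2 - (n * t⁻¹) ^ 2 = s ^ 2 + 2 * n * h := by
    have hab'' : (n : RatFunc ℂ) * RatFunc.C b = 0 := by
      rw [← map_intCast (RatFunc.C (K := ℂ)), ← map_mul, hab', map_zero]
    have e : (n : RatFunc ℂ) * s = t * (n * h) := by
      rw [hsb]
      linear_combination hab''
    have e' : t⁻¹ * (n * s) = n * h := by rw [e, inv_mul_cancel_left₀ ht0]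
    rw [w0]
    linear_combination 2 * e'
  refine ⟨n, hn, e1 ▸ hs, ?_⟩
  -- The cross term 2(n/t)s is regular because n·b = 0, so w² has no simple-pole part.
  rw [e2]
  exact add_mem (pow_mem hs 2) (mul_mem (mul_mem (ofNat_mem _ 2) (intCast_mem _ n)) hh)

/-! ### Tau functions -/

/-- The logarithmic derivative of a polynomial, as a rational function. -/
def polyLogDeriv (p : ℂ[X]) : RatFunc ℂ := ratLogDeriv (algebraMap ℂ[X] (RatFunc ℂ) p)

theorem polyLogDeriv_one : polyLogDeriv 1 = 0 := by
  rw [polyLogDeriv, map_one, ratLogDeriv_one]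

theorem polyLogDeriv_prod (s : Finset ℂ) (n : ℂ → ℕ) :
    polyLogDeriv (∏ c ∈ s, (X - C c) ^ n c) = ∑ c ∈ s, (n c : RatFunc ℂ) * (linear c)⁻¹ := by
  rw [polyLogDeriv, map_prod,
    ratLogDeriv_prod _ _ fun c _ => by
      rw [map_pow]; exact pow_ne_zero _ (linear_ne_zero c)]
  refine Finset.sum_congr rfl fun c _ => ?_
  rw [map_pow, ← linear, ratLogDeriv_pow (linear_ne_zero c), ratLogDeriv, ratDeriv_linear, one_div]

theorem ratDeriv_linear_inv (c : ℂ) : ratDeriv (linear c)⁻¹ = -(linear c)⁻¹ ^ 2 := by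
  rw [ratDeriv_inv (linear_ne_zero c), ratDeriv_linear, inv_pow, div_eq_mul_inv, neg_one_mul]

theorem polyLogDeriv_mem_degLE {p : ℂ[X]} (hp : p ≠ 0) : polyLogDeriv p ∈ degLE (-1) := by
  rw [polyLogDeriv, ratLogDeriv, ratDeriv_algebraMap]
  by_cases h : p.natDegree = 0
  · rw [derivative_of_natDegree_zero h, map_zero, zero_div]
    exact zero_mem _
  · have := natDegree_derivative_lt h
    exact div_mem_degLE hp (by omega)

/-- The leading terms of zp' and (deg p)p cancel. -/
theorem X_mul_polyLogDeriv_sub_mem_degLE {p : ℂ[X]} (hp : p ≠ 0) :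
    RatFunc.X * polyLogDeriv p - RatFunc.C (p.natDegree : ℂ) ∈ degLE (-1) := by
  have hp' := RatFunc.algebraMap_ne_zero (K := ℂ) hp
  have e : RatFunc.X * polyLogDeriv p - RatFunc.C (p.natDegree : ℂ) =
      algebraMap ℂ[X] (RatFunc ℂ) (X * derivative p - C (p.natDegree : ℂ) * p) /
        algebraMap ℂ[X] (RatFunc ℂ) p := by
    rw [polyLogDeriv, ratLogDeriv, ratDeriv_algebraMap, map_sub, map_mul, map_mul,
      RatFunc.algebraMap_X, RatFunc.algebraMap_C]
    field_simp
  rw [e]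
  by_cases h0 : X * derivative p - C (p.natDegree : ℂ) * p = 0
  · rw [h0, map_zero, zero_div]
    exact zero_mem _
  refine div_mem_degLE hp ?_
  have hdeg : (X * derivative p - C (p.natDegree : ℂ) * p).degree <
      (p.natDegree : WithBot ℕ) := by
    rw [degree_lt_iff_coeff_zero]
    intro m hm
    have hc : (X * derivative p).coeff m = m * p.coeff m := by
      cases m with
      | zero => simp
      | succ m => rw [coeff_X_mul, coeff_derivative]; push_cast; ring
    rw [coeff_sub, hc, coeff_C_mul]
    rcases hm.eq_or_lt with rfl | hm
    · ring
    · rw [coeff_eq_zero_of_natDegree_lt hm]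
      ring
  have := (natDegree_lt_iff_degree_lt h0).2 hdeg
  omega

theorem sum_principal_sub_mem_regularAt (s : Finset ℂ) (n : ℂ → ℕ) (hn : ∀ c ∉ s, n c = 0)
    (k : ℕ) (c : ℂ) :
    ∑ b ∈ s, (n b : RatFunc ℂ) * (linear b)⁻¹ ^ k - n c * (linear c)⁻¹ ^ k ∈ regularAt c := by
  classical
  have h : ∀ b ∈ s.erase c, (n b : RatFunc ℂ) * (linear b)⁻¹ ^ k ∈ regularAt c := fun b hb =>
    mul_mem (natCast_mem _ _)
      (pow_mem (linear_inv_mem_regularAt (Finset.ne_of_mem_erase hb).symm) k)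
  by_cases hc : c ∈ s
  · rw [← Finset.add_sum_erase s _ hc, add_sub_cancel_left]
    exact sum_mem h
  · rw [hn c hc, Nat.cast_zero, zero_mul, sub_zero]
    rw [Finset.erase_eq_of_notMem hc] at h
    exact sum_mem h

/-- Every rational solution is the logarithmic derivative of a quotient of two polynomials, whose
second logarithmic derivatives are given by the two Miura transforms. -/
theorem exists_tau {β : ℂ} {w : RatFunc ℂ} (hw : IsRationalSolution β w) :
    ∃ N T : ℂ[X], N.Monic ∧ T.Monic ∧ w = polyLogDeriv N - polyLogDeriv T ∧
      3 * ratDeriv (polyLogDeriv N) = -miuraOne w ∧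
      3 * ratDeriv (polyLogDeriv T) = -miuraTwo w := by
  choose a ha h1 h2 using exists_residue hw
  -- The multiplicities are n = a(a + 2)/3 and m = a(a - 1)/3, natural numbers for all the
  -- admissible residues, with n - m = a.
  have hn : ∀ c, ∃ n : ℕ, 3 * (n : ℤ) = a c ^ 2 + 2 * a c := fun c => by
    rcases ha c with h | h | h | h | h <;> rw [h]
    exacts [⟨0, by norm_num⟩, ⟨1, by norm_num⟩, ⟨0, by norm_num⟩, ⟨1, by norm_num⟩,
      ⟨8, by norm_num⟩]
  have hm : ∀ c, ∃ m : ℕ, 3 * (m : ℤ) = a c ^ 2 - a c := fun c => by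
    rcases ha c with h | h | h | h | h <;> rw [h]
    exacts [⟨0, by norm_num⟩, ⟨0, by norm_num⟩, ⟨2, by norm_num⟩, ⟨4, by norm_num⟩,
      ⟨4, by norm_num⟩]
  choose n hn using hn
  choose m hm using hm
  have hn' : ∀ c, 3 * (n c : RatFunc ℂ) = (a c : RatFunc ℂ) ^ 2 + 2 * a c :=
    fun c => by exact_mod_cast congrArg (Int.cast : ℤ → RatFunc ℂ) (hn c)
  have hm' : ∀ c, 3 * (m c : RatFunc ℂ) = (a c : RatFunc ℂ) ^ 2 - a c :=
    fun c => by exact_mod_cast congrArg (Int.cast : ℤ → RatFunc ℂ) (hm c)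
  have hnm : ∀ c, (n c : RatFunc ℂ) - m c = a c := fun c => by
    linear_combination (hn' c - hm' c) / 3
  set s := w.denom.roots.toFinset with hs
  have ha0 : ∀ c ∉ s, a c = 0 := by
    intro c hc
    have hwc : w ∈ regularAt c := by
      refine ⟨w.num, w.denom, fun h0 => hc ?_, w.num_div_denom.symm⟩
      rw [hs, Multiset.mem_toFinset, mem_roots w.denom_ne_zero]
      exact h0
    have h := sub_mem hwc (h1 c)
    rw [sub_sub_cancel] at h
    have := eq_zero_of_C_eq_linear_mul (a := (a c : ℂ)) h (by
      rw [mul_comm, mul_assoc, inv_mul_cancel₀ (linear_ne_zero c), mul_one, map_intCast])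
    exact_mod_cast this
  have hn0 : ∀ c ∉ s, n c = 0 := fun c hc => by
    have := hn c
    rw [ha0 c hc] at this
    omega
  have hm0 : ∀ c ∉ s, m c = 0 := fun c hc => by
    have := hm c
    rw [ha0 c hc] at this
    omega
  have hmonic : ∀ k : ℂ → ℕ, (∏ c ∈ s, (X - C c) ^ k c).Monic := fun k =>
    monic_prod_of_monic _ _ fun c _ => (monic_X_sub_C c).pow _
  have hderiv : ∀ k : ℂ → ℕ, ratDeriv (polyLogDeriv (∏ c ∈ s, (X - C c) ^ k c)) =
      -∑ c ∈ s, (k c : RatFunc ℂ) * (linear c)⁻¹ ^ 2 := fun k => by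
    rw [polyLogDeriv_prod, ratDeriv_sum, ← Finset.sum_neg_distrib]
    refine Finset.sum_congr rfl fun c _ => ?_
    rw [ratDeriv_natCast_mul, ratDeriv_linear_inv]
    ring
  have hreg : ∀ c, ratDeriv w + a c * (linear c)⁻¹ ^ 2 ∈ regularAt c := fun c => by
    have h := ratDeriv_mem_regularAt (h1 c)
    have e : ratDeriv (a c * (linear c)⁻¹) = -(a c * (linear c)⁻¹ ^ 2) := by
      rw [← map_intCast (RatFunc.C (K := ℂ)), ratDeriv_C_mul, ratDeriv_linear_inv]
      ring
    rwa [ratDeriv_sub, e, sub_neg_eq_add] at h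
  have hw0 := solution_mem_degLE hw
  have hw1 := degLE_mono (k := -1) (by omega) (ratDeriv_mem_degLE hw0)
  have hw2 : w ^ 2 ∈ degLE (-1) := degLE_mono (by norm_num) (pow_mem_degLE hw0 2)
  have hinf : ∀ k : ℂ → ℕ,
      3 * ratDeriv (polyLogDeriv (∏ c ∈ s, (X - C c) ^ k c)) ∈ degLE (-1) := fun k =>
    mul_mem_degLE (ofNat_mem_degLE 3)
      (ratDeriv_mem_degLE (polyLogDeriv_mem_degLE (hmonic k).ne_zero)) (by norm_num)
  refine ⟨_, _, hmonic n, hmonic m, ?_, ?_, ?_⟩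
  · refine sub_eq_zero.1 (eq_zero_of_forall_regularAt (fun c => ?_)
      (sub_mem hw0 (sub_mem (polyLogDeriv_mem_degLE (hmonic n).ne_zero)
        (polyLogDeriv_mem_degLE (hmonic m).ne_zero))))
    have r1 := sum_principal_sub_mem_regularAt s n hn0 1 c
    have r2 := sum_principal_sub_mem_regularAt s m hm0 1 c
    have r := sub_mem (h1 c) (sub_mem r1 r2)
    simp only [pow_one] at r
    rw [polyLogDeriv_prod, polyLogDeriv_prod]
    convert r using 1
    linear_combination -(linear c)⁻¹ * hnm c
  · refine eq_neg_of_add_eq_zero_left (eq_zero_of_forall_regularAt (fun c => ?_)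
      (add_mem (hinf n) (sub_mem hw2 (mul_mem_degLE (ofNat_mem_degLE 2) hw1 (by norm_num)))))
    have r := sub_mem (sub_mem (h2 c) (mul_mem (ofNat_mem _ 2) (hreg c)))
      (mul_mem (ofNat_mem _ 3) (sum_principal_sub_mem_regularAt s n hn0 2 c))
    rw [hderiv, miuraOne]
    convert r using 1
    linear_combination (linear c)⁻¹ ^ 2 * (-hn' c)
  · refine eq_neg_of_add_eq_zero_left (eq_zero_of_forall_regularAt (fun c => ?_)
      (add_mem (hinf m) (add_mem hw2 hw1)))
    have r := sub_mem (add_mem (h2 c) (hreg c))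
      (mul_mem (ofNat_mem _ 3) (sum_principal_sub_mem_regularAt s m hm0 2 c))
    rw [hderiv, miuraTwo]
    convert r using 1
    linear_combination (linear c)⁻¹ ^ 2 * (-hm' c)

/-- Decay at infinity kills the constant of integration. -/
theorem polyLogDeriv_eq_of_ratDeriv_eq {p q : ℂ[X]} (hp : p.Monic) (hq : q.Monic)
    (h : 3 * ratDeriv (polyLogDeriv p) = 3 * ratDeriv (polyLogDeriv q)) :
    polyLogDeriv p = polyLogDeriv q := by
  refine sub_eq_zero.1 (eq_zero_of_ratDeriv_eq_zero
    (sub_mem (polyLogDeriv_mem_degLE hp.ne_zero) (polyLogDeriv_mem_degLE hq.ne_zero)) ?_)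
  rw [ratDeriv_sub]
  linear_combination h / 3

/-! ### The admissible parameters -/

theorem X_sq_mul_ratDeriv_add_mem_degLE {f : RatFunc ℂ} {d : ℂ}
    (h : RatFunc.X * f - RatFunc.C d ∈ degLE (-1)) :
    RatFunc.X ^ 2 * ratDeriv f + RatFunc.C d ∈ degLE (-1) := by
  have h1 := ratDeriv_mem_degLE h
  rw [ratDeriv_sub, ratDeriv_mul, ratDeriv_X, ratDeriv_C] at h1
  have h2 := sub_mem (mul_mem_degLE (l := -1) X_mem_degLE h1 (by norm_num)) h
  convert h2 using 1
  ring

theorem exists_int_param {β : ℂ} {w : RatFunc ℂ} (hw : IsRationalSolution β w) :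
    ∃ m : ℤ, β = m ∧ ∃ d : ℤ, m ^ 2 - 2 * m = 3 * d := by
  obtain ⟨N, T, hN, hT, hNT, hN', -⟩ := exists_tau hw
  have f1 := X_mul_polyLogDeriv_sub_mem_degLE hN.ne_zero
  have g1 := X_mul_polyLogDeriv_sub_mem_degLE hT.ne_zero
  have f2 := X_sq_mul_ratDeriv_add_mem_degLE f1
  have w1 := X_mul_solution_add_mem_degLE hw
  have w2 := X_sq_mul_ratDeriv_add_mem_degLE (d := -β) (by
    rwa [map_neg, sub_neg_eq_add])
  -- Compares the 1/z coefficients in w = (ln N/T)'.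
  have e1 : β + N.natDegree - T.natDegree = 0 := by
    refine eq_zero_of_C_mem_degLE ?_
    convert sub_mem w1 (sub_mem f1 g1) using 1
    rw [hNT, map_sub, map_add]
    ring
  -- Compares the 1/z² coefficients in 3(ln N)'' = -(w² - 2w'), using w ~ -β/z; the product (zw +
  -- β)(zw - β) supplies the w² term.
  have e2 : β ^ 2 - 2 * β - 3 * N.natDegree = 0 := by
    refine eq_zero_of_C_mem_degLE ?_
    have w0 : RatFunc.X * w - RatFunc.C β ∈ degLE 0 := by
      convert sub_mem (degLE_mono (by norm_num) w1)
        (mul_mem_degLE (l := 0) (ofNat_mem_degLE 2) (C_mem_degLE β) (by norm_num)) using 1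
      ring
    have w3 := mul_mem_degLE (l := -1) w1 w0 (by norm_num)
    have f3 := mul_mem_degLE (l := -1) (ofNat_mem_degLE 3) f2 (by norm_num)
    have w4 := mul_mem_degLE (l := -1) (ofNat_mem_degLE 2) w2 (by norm_num)
    convert neg_mem (add_mem (sub_mem w3 w4) f3) using 1
    rw [miuraOne] at hN'
    simp only [map_sub, map_mul, map_pow, map_neg, map_ofNat]
    linear_combination RatFunc.X ^ 2 * hN'
  have hβ : β = ((T.natDegree - N.natDegree : ℤ) : ℂ) := by
    push_cast
    linear_combination e1
  refine ⟨_, hβ, N.natDegree, ?_⟩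
  rw [hβ] at e2
  rw [← sub_eq_zero]
  exact_mod_cast e2

theorem betaOne_even (k : ℕ) : betaOne (2 * k) = 3 * k := by
  have h : (2 * k + 1) / 2 = k := by omega
  simp [betaOne, h, pow_mul]

theorem betaOne_odd (k : ℕ) : betaOne (2 * k + 1) = -(3 * k + 1) := by
  have h : (2 * k + 1 + 1) / 2 = k + 1 := by omega
  simp only [betaOne, h, pow_succ, pow_mul]
  push_cast
  norm_num
  ring

theorem betaTwo_even (k : ℕ) : betaTwo (2 * k) = -(3 * k) := by
  have h : 2 * k / 2 = k := by omega
  simp [betaTwo, h, pow_succ, pow_mul]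

theorem betaTwo_odd (k : ℕ) : betaTwo (2 * k + 1) = 3 * k + 2 := by
  have h : (2 * k + 1) / 2 = k := by omega
  simp only [betaTwo, h, pow_succ, pow_mul]
  norm_num
  ring

theorem isRationalSolution_zero : IsRationalSolution 0 0 := by
  have h : ∀ n, ratDeriv^[n] 0 = 0 := fun n => by
    induction n with
    | zero => rfl
    | succ n ih => rw [Function.iterate_succ_apply, ratDeriv_zero, ih]
  simp [IsRationalSolution, h, ratDeriv_zero]

/-! ### Existence along the two chains of parameters. -/

theorem exists_solution_int_two_sub {m n : ℤ} {w : RatFunc ℂ}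
    (hw : IsRationalSolution (m : ℂ) w) (hm : m ≠ 1) (hn : n = 2 - m) :
    ∃ w', IsRationalSolution (n : ℂ) w' ∧ miuraOne w' = miuraOne w := by
  have h := exists_solution_two_sub hw (by exact_mod_cast hm)
  rw [hn]
  push_cast
  exact h

theorem exists_solution_int_neg_one_sub {m n : ℤ} {w : RatFunc ℂ}
    (hw : IsRationalSolution (m : ℂ) w) (hn : n = -1 - m) :
    ∃ w', IsRationalSolution (n : ℂ) w' ∧ miuraTwo w' = miuraTwo w := by
  have h := exists_solution_neg_one_sub hw (by
    have : 1 + 2 * m ≠ 0 := by omega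
    exact_mod_cast this)
  rw [hn]
  push_cast
  exact h

/-- The chain is 0, -1, 3, -4, 6, …, with β ↦ -1 - β applied first. -/
theorem exists_solution_betaOne (n : ℕ) :
    ∃ w, IsRationalSolution (betaOne n : ℂ) w := by
  induction n with
  | zero => exact ⟨0, by simpa [betaOne] using isRationalSolution_zero⟩
  | succ n ih =>
    obtain ⟨w, hw⟩ := ih
    rcases Nat.even_or_odd' n with ⟨k, rfl | rfl⟩
    · have h := exists_solution_int_neg_one_sub hw (n := betaOne (2 * k + 1))
        (by rw [betaOne_even, betaOne_odd]; ring)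
      exact h.imp fun _ h => h.1
    · have h := exists_solution_int_two_sub hw (n := betaOne (2 * (k + 1)))
        (by rw [betaOne_odd]; omega) (by rw [betaOne_even, betaOne_odd]; push_cast; ring)
      exact h.imp fun _ h => h.1

/-- The chain is 0, 2, -3, 5, -6, …, with β ↦ 2 - β applied first. -/
theorem exists_solution_betaTwo (n : ℕ) :
    ∃ w, IsRationalSolution (betaTwo n : ℂ) w := by
  induction n with
  | zero => exact ⟨0, by simpa [betaTwo] using isRationalSolution_zero⟩
  | succ n ih =>
    obtain ⟨w, hw⟩ := ih
    rcases Nat.even_or_odd' n with ⟨k, rfl | rfl⟩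
    · have h := exists_solution_int_two_sub hw (n := betaTwo (2 * k + 1))
        (by rw [betaTwo_even]; omega) (by rw [betaTwo_even, betaTwo_odd]; ring)
      exact h.imp fun _ h => h.1
    · have h := exists_solution_int_neg_one_sub hw (n := betaTwo (2 * (k + 1)))
        (by rw [betaTwo_even, betaTwo_odd]; push_cast; ring)
      exact h.imp fun _ h => h.1

/-! ### Gluing tau functions into the sequences Q and R. -/

theorem miuraOne_eq_of_solutions {m n : ℤ} {v w : RatFunc ℂ}
    (hv : IsRationalSolution (m : ℂ) v) (hw : IsRationalSolution (n : ℂ) w) (hm : m ≠ 1)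
    (hn : n = 2 - m) : miuraOne w = miuraOne v := by
  obtain ⟨w', hw', h⟩ := exists_solution_int_two_sub hv hm hn
  rw [solution_unique hw hw', h]

theorem miuraTwo_eq_of_solutions {m n : ℤ} {v w : RatFunc ℂ}
    (hv : IsRationalSolution (m : ℂ) v) (hw : IsRationalSolution (n : ℂ) w)
    (hn : n = -1 - m) : miuraTwo w = miuraTwo v := by
  obtain ⟨w', hw', h⟩ := exists_solution_int_neg_one_sub hv hn
  rw [solution_unique hw hw', h]

/-- Two sequences of polynomials whose logarithmic derivatives agree alternately at consecutive
indices interlace into a single sequence. -/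
theorem exists_interlacing {A B : ℕ → ℂ[X]} (hA : ∀ n, (A n).Monic) (hB : ∀ n, (B n).Monic)
    (h0 : polyLogDeriv (B 0) = 0)
    (heven : ∀ k, polyLogDeriv (B (2 * k + 1)) = polyLogDeriv (B (2 * k)))
    (hodd : ∀ k, polyLogDeriv (A (2 * (k + 1))) = polyLogDeriv (A (2 * k + 1))) :
    ∃ Q : ℕ → ℂ[X], (∀ n, (Q n).Monic) ∧ Q 0 = 1 ∧
      ∀ n, polyLogDeriv (A (n + 1)) - polyLogDeriv (B (n + 1)) =
        (-1) ^ (n + 1) * (polyLogDeriv (Q n) - polyLogDeriv (Q (n + 1))) := by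
  classical
  -- The value 1 at index 0 is harmless, since `B 0` has zero logarithmic derivative.
  let Q : ℕ → ℂ[X] := fun n => if n = 0 then 1 else if Even n then B n else A n
  have hQe : ∀ k, polyLogDeriv (Q (2 * k)) = polyLogDeriv (B (2 * k)) := fun k => by
    rcases Nat.eq_zero_or_pos k with rfl | hk
    · simp only [Q, mul_zero, if_true, h0, polyLogDeriv_one]
    · have : 2 * k ≠ 0 := by omega
      simp only [Q, this, if_false, even_two_mul, if_true]
  have hQo : ∀ k, polyLogDeriv (Q (2 * k + 1)) = polyLogDeriv (A (2 * k + 1)) := fun k => by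
    have : ¬ Even (2 * k + 1) := by rw [Nat.not_even_iff_odd]; exact odd_two_mul_add_one k
    simp only [Q, Nat.succ_ne_zero, this, if_false]
  refine ⟨Q, fun n => ?_, if_pos rfl, fun n => ?_⟩
  · simp only [Q]
    split_ifs
    exacts [monic_one, hB n, hA n]
  · rcases Nat.even_or_odd' n with ⟨k, rfl | rfl⟩
    · rw [hQe, hQo, heven, (odd_two_mul_add_one k).neg_one_pow]
      ring
    · rw [show 2 * k + 1 + 1 = 2 * (k + 1) by ring, hQe, hQo, hodd,
        (even_two_mul (k + 1)).neg_one_pow]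
      ring

theorem solOne_succ {Q : ℕ → ℂ[X]} (hQ : ∀ n, (Q n).Monic) (n : ℕ) :
    solOne Q (n + 1) = (-1) ^ (n + 1) * (polyLogDeriv (Q n) - polyLogDeriv (Q (n + 1))) := by
  rw [solOne, Nat.add_sub_cancel, ratLogDeriv_div (RatFunc.algebraMap_ne_zero (hQ _).ne_zero)
    (RatFunc.algebraMap_ne_zero (hQ _).ne_zero)]
  rfl

theorem solTwo_succ {R : ℕ → ℂ[X]} (hR : ∀ n, (R n).Monic) (n : ℕ) :
    solTwo R (n + 1) = (-1) ^ n * (polyLogDeriv (R n) - polyLogDeriv (R (n + 1))) := by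
  rw [solTwo, Nat.add_sub_cancel, ratLogDeriv_div (RatFunc.algebraMap_ne_zero (hR _).ne_zero)
    (RatFunc.algebraMap_ne_zero (hR _).ne_zero)]
  rfl

theorem exists_solOne : ∃ Q : ℕ → ℂ[X], (∀ n, (Q n).Monic) ∧ Q 0 = 1 ∧
    ∀ n, 1 ≤ n → IsRationalSolution (betaOne n : ℂ) (solOne Q n) := by
  choose w hw using exists_solution_betaOne
  choose N T hN hT hNT hN' hT' using fun n => exists_tau (hw n)
  have w0 : w 0 = 0 := solution_unique (hw 0) (by simpa [betaOne] using isRationalSolution_zero)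
  -- Here β ↦ -1 - β comes first, so T is shared from even to odd indices and N from odd to even.
  obtain ⟨Q, hQ, hQ0, h⟩ := exists_interlacing hN hT
    (by
      rw [← polyLogDeriv_one]
      refine polyLogDeriv_eq_of_ratDeriv_eq (hT 0) monic_one ?_
      simp [hT', w0, miuraTwo, polyLogDeriv_one, ratDeriv_zero])
    (fun k => polyLogDeriv_eq_of_ratDeriv_eq (hT _) (hT _) (by
      rw [hT', hT', miuraTwo_eq_of_solutions (hw (2 * k)) (hw (2 * k + 1))
        (by rw [betaOne_even, betaOne_odd]; ring)]))
    (fun k => polyLogDeriv_eq_of_ratDeriv_eq (hN _) (hN _) (by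
      rw [hN', hN', miuraOne_eq_of_solutions (hw (2 * k + 1)) (hw (2 * (k + 1)))
        (by rw [betaOne_odd]; omega)
        (by rw [betaOne_even, betaOne_odd]; push_cast; ring)]))
  refine ⟨Q, hQ, hQ0, fun n hn => ?_⟩
  obtain ⟨n, rfl⟩ := Nat.exists_eq_add_of_le' hn
  rw [solOne_succ hQ, ← h, ← hNT]
  exact hw _

theorem exists_solTwo : ∃ R : ℕ → ℂ[X], (∀ n, (R n).Monic) ∧ R 0 = 1 ∧
    ∀ n, 1 ≤ n → IsRationalSolution (betaTwo n : ℂ) (solTwo R n) := by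
  choose w hw using exists_solution_betaTwo
  choose N T hN hT hNT hN' hT' using fun n => exists_tau (hw n)
  have w0 : w 0 = 0 := solution_unique (hw 0) (by simpa [betaTwo] using isRationalSolution_zero)
  -- The moves alternate in the other order, so N and T swap roles; this accounts for the opposite
  -- sign in `solTwo`.
  obtain ⟨R, hR, hR0, h⟩ := exists_interlacing hT hN
    (by
      rw [← polyLogDeriv_one]
      refine polyLogDeriv_eq_of_ratDeriv_eq (hN 0) monic_one ?_
      simp [hN', w0, miuraOne, polyLogDeriv_one, ratDeriv_zero])
    (fun k => polyLogDeriv_eq_of_ratDeriv_eq (hN _) (hN _) (by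
      rw [hN', hN', miuraOne_eq_of_solutions (hw (2 * k)) (hw (2 * k + 1))
        (by rw [betaTwo_even]; omega)
        (by rw [betaTwo_even, betaTwo_odd]; ring)]))
    (fun k => polyLogDeriv_eq_of_ratDeriv_eq (hT _) (hT _) (by
      rw [hT', hT', miuraTwo_eq_of_solutions (hw (2 * k + 1)) (hw (2 * (k + 1)))
        (by rw [betaTwo_even, betaTwo_odd]; push_cast; ring)]))
  refine ⟨R, hR, hR0, fun n hn => ?_⟩
  obtain ⟨n, rfl⟩ := Nat.exists_eq_add_of_le' hn
  have e : solTwo R (n + 1) = w (n + 1) := by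
    rw [solTwo_succ hR, hNT]
    linear_combination h n
  rw [e]
  exact hw _

/-! ### Arithmetic of the parameters modulo 3. -/

theorem not_one_mod_three_of_solution {m : ℤ} {w : RatFunc ℂ}
    (hw : IsRationalSolution (m : ℂ) w) : m % 3 = 0 ∨ m % 3 = 2 := by
  obtain ⟨m', hm, d, hd⟩ := exists_int_param hw
  obtain rfl : m = m' := by exact_mod_cast hm
  by_contra hne
  obtain ⟨k, rfl⟩ : ∃ k, m = 1 + 3 * k := ⟨m / 3, by omega⟩
  -- Completing the square: m² - 2m = (m - 1)² - 1 = 9k² - 1.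
  have : 3 * (3 * (k * k) - d) = 1 := by linear_combination hd
  omega

theorem eq_beta_of_mod_three {m : ℤ} (h : m % 3 = 0 ∨ m % 3 = 2) :
    (∃ n : ℕ, 1 ≤ n ∧ m = betaOne n) ∨ (∃ n : ℕ, 1 ≤ n ∧ m = betaTwo n) ∨ m = 0 := by
  rcases lt_trichotomy m 0 with hm | hm | hm
  · rcases h with h | h
    · exact Or.inr (Or.inl ⟨2 * (-m / 3).toNat, by omega, by rw [betaTwo_even]; omega⟩)
    · exact Or.inl ⟨2 * (-m / 3).toNat + 1, by omega, by rw [betaOne_odd]; omega⟩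
  · exact Or.inr (Or.inr hm)
  · rcases h with h | h
    · exact Or.inl ⟨2 * (m / 3).toNat, by omega, by rw [betaOne_even]; omega⟩
    · exact Or.inr (Or.inl ⟨2 * (m / 3).toNat + 1, by omega, by rw [betaTwo_odd]; omega⟩)

theorem mod_three_iff (m : ℤ) :
    (m % 3 = 0 ∨ m % 3 = 2) ↔ ∀ k : ℕ, m ≠ 1 + 3 * (k : ℤ) ∧ m ≠ 1 - 3 * (k : ℤ) := by
  constructor
  · intro h k
    omega
  · intro h
    have h1 := h ((m - 1) / 3).toNat
    have h2 := h ((1 - m) / 3).toNat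
    omega

end FourthPainleve

end

theorem theorem2p1 :
    -- rational solutions exist exactly at the integers not of the form `1 ± 3k`
    (∀ β : ℂ, (∃ w : RatFunc ℂ, FourthPainleve.IsRationalSolution β w) ↔
      ∃ m : ℤ, β = (m : ℂ) ∧ ∀ k : ℕ, m ≠ 1 + 3 * (k : ℤ) ∧ m ≠ 1 - 3 * (k : ℤ)) ∧
    -- for each `β` there is at most one
    (∀ (β : ℂ) (w₁ w₂ : RatFunc ℂ), FourthPainleve.IsRationalSolution β w₁ →
      FourthPainleve.IsRationalSolution β w₂ → w₁ = w₂) ∧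
    -- they are the two families of logarithmic derivatives and the trivial solution at `β = 0`
    (∃ Q R : ℕ → Polynomial ℂ,
      (∀ n, (Q n).Monic) ∧ (∀ n, (R n).Monic) ∧ Q 0 = 1 ∧ R 0 = 1 ∧
      (∀ n : ℕ, 1 ≤ n → FourthPainleve.IsRationalSolution
        (FourthPainleve.betaOne n : ℂ) (FourthPainleve.solOne Q n)) ∧
      (∀ n : ℕ, 1 ≤ n → FourthPainleve.IsRationalSolution
        (FourthPainleve.betaTwo n : ℂ) (FourthPainleve.solTwo R n)) ∧
      FourthPainleve.IsRationalSolution 0 0 ∧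
      (∀ (β : ℂ) (w : RatFunc ℂ), FourthPainleve.IsRationalSolution β w →
        (∃ n : ℕ, 1 ≤ n ∧ β = (FourthPainleve.betaOne n : ℂ) ∧
          w = FourthPainleve.solOne Q n) ∨
        (∃ n : ℕ, 1 ≤ n ∧ β = (FourthPainleve.betaTwo n : ℂ) ∧
          w = FourthPainleve.solTwo R n) ∨
        (β = 0 ∧ w = 0))) := by
  obtain ⟨Q, hQ, hQ0, hQs⟩ := FourthPainleve.exists_solOne
  obtain ⟨R, hR, hR0, hRs⟩ := FourthPainleve.exists_solTwo
  refine ⟨fun β => ⟨?_, ?_⟩, fun β w₁ w₂ h₁ h₂ => FourthPainleve.solution_unique h₁ h₂,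
    Q, R, hQ, hR, hQ0, hR0, hQs, hRs, FourthPainleve.isRationalSolution_zero, ?_⟩
  · rintro ⟨w, hw⟩
    obtain ⟨m, rfl, -⟩ := FourthPainleve.exists_int_param hw
    exact ⟨m, rfl, (FourthPainleve.mod_three_iff m).1
      (FourthPainleve.not_one_mod_three_of_solution hw)⟩
  · rintro ⟨m, rfl, hm⟩
    rcases FourthPainleve.eq_beta_of_mod_three ((FourthPainleve.mod_three_iff m).2 hm) with
      ⟨n, hn, rfl⟩ | ⟨n, hn, rfl⟩ | rfl
    · exact ⟨_, hQs n hn⟩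
    · exact ⟨_, hRs n hn⟩
    · exact ⟨0, by simpa using FourthPainleve.isRationalSolution_zero⟩
  · intro β w hw
    obtain ⟨m, rfl, -⟩ := FourthPainleve.exists_int_param hw
    rcases FourthPainleve.eq_beta_of_mod_three
      (FourthPainleve.not_one_mod_three_of_solution hw) with
      ⟨n, hn, rfl⟩ | ⟨n, hn, rfl⟩ | rfl
    · exact Or.inl ⟨n, hn, rfl, FourthPainleve.solution_unique hw (hQs n hn)⟩
    · exact Or.inr (Or.inl ⟨n, hn, rfl, FourthPainleve.solution_unique hw (hRs n hn)⟩)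
    · rw [Int.cast_zero] at hw ⊢
      exact Or.inr (Or.inr ⟨rfl,
        FourthPainleve.solution_unique hw FourthPainleve.isRationalSolution_zero⟩)
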